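/- Let $n\ge 3$, let $(c_1,\dots,c_n)$ be a sequence of positive integers, and put $$M_q(c_1,\dots,c_n)=\prod_{i=1}^{n}\begin{pmatrix}[c_i]_q & -q^{c_i-1}\\ 1&0\end{pmatrix},\qquad [c]_q=1+q+\dots+q^{c-1},$$ (product taken from left to right), a $2\times 2$ matrix over $\mathbb{Z}[q,q^{-1}]$, $q$ being an indeterminate. A dissection of a convex $n$-gon is a (possibly empty) set of pairwise non-crossing diagonals; its quiddity is the sequence whose $i$-th term is the number of sub-polygons incident with the $i$-th vertex, the vertices being numbered in cyclic order. A triangulation is a dissection into triangles; a $3d$-dissection is a dissection in which the number of vertices of every sub-polygon is a multiple of $3$. (i) If $(c_1,\dots,c_n)$ is the quiddity of a triangulation of the $n$-gon, then $M_q(c_1,\dots,c_n)=-q^{n-3}\,\mathrm{Id}$. (ii) There is an integer $\ell$ with $M_q(c_1,\dots,c_n)=\pm q^{\ell}\,\mathrm{Id}$ if and only if $(c_1,\dots,c_n)$ is the quiddity of a $3d$-dissection of the $n$-gon. Moreover, for every $3d$-dissection with quiddity $(c_1,\dots,c_n)$, one has $M_q(c_1,\dots,c_n)=\pm q^{\ell}\,\mathrm{Id}$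 where $\ell$ is its number of diagonals (so $\ell=n-3$ for a triangulation). -/

import Mathlib

open scoped LaurentPolynomial

noncomputable section

namespace QContinuant

/-- The `q`-integer `[a]_q = 1 + q + ⋯ + q^(a-1)` in `ℤ[q, q⁻¹]`, where `q` is the
variable `LaurentPolynomial.T 1`. -/
def qInt (a : ℕ) : ℤ[T;T⁻¹] :=
  ∑ k ∈ Finset.range a, LaurentPolynomial.T (k : ℤ)

/-- The elementary matrix with rows `([c]_q, -q^(c-1))` and `(1, 0)`. -/
def elemMatrix (c : ℕ) : Matrix (Fin 2) (Fin 2) ℤ[T;T⁻¹] :=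
  !![qInt c, -LaurentPolynomial.T ((c : ℤ) - 1); 1, 0]

/-- `M_q(c₁, …, cₙ)`: the product, from left to right, of the elementary matrices of the `cᵢ`. -/
def Mq {n : ℕ} (c : Fin n → ℕ) : Matrix (Fin 2) (Fin 2) ℤ[T;T⁻¹] :=
  (List.ofFn fun i => elemMatrix (c i)).prod

/-- The vertices of a convex `n`-gon are labelled in cyclic order by `Fin n`. For a set `P` of
vertices containing `i < j`, the segment `ij` is a side of the convex hull of `P`
when no vertex of `P` lies strictly on one of the two sides of the line `ij`. For `P = univ` these
are the sides of the `n`-gon itself. -/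
def IsSide {n : ℕ} (P : Finset (Fin n)) (i j : Fin n) : Prop :=
  (∀ k ∈ P, ¬ (i < k ∧ k < j)) ∨ (∀ k ∈ P, i ≤ k ∧ k ≤ j)

/-- A dissection of a convex `n`-gon: a set of pairwise non-crossing diagonals. A diagonal is
recorded as the pair `(i, j)` of its end points with `i < j`. -/
structure Dissection (n : ℕ) where
  diagonals : Finset (Fin n × Fin n)
  isDiagonal : ∀ d ∈ diagonals, d.1 < d.2 ∧ ¬ IsSide Finset.univ d.1 d.2
  nonCrossing : ∀ d ∈ diagonals, ∀ e ∈ diagonals, ¬ (d.1 < e.1 ∧ e.1 < d.2 ∧ d.2 < e.2)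

namespace Dissection

variable {n : ℕ} (D : Dissection n)

/-- `P` is the vertex set of one of the sub-polygons into which `D` cuts the `n`-gon: it has at
least three vertices, each side of the convex hull of `P` is a side of the `n`-gon or a
diagonal of `D`, and no diagonal of `D` cuts through the interior of the hull. -/
def IsSubPolygon (P : Finset (Fin n)) : Prop :=
  3 ≤ P.card ∧
  (∀ i ∈ P, ∀ j ∈ P, i < j → IsSide P i j →
    IsSide Finset.univ i j ∨ (i, j) ∈ D.diagonals) ∧
  (∀ i ∈ P, ∀ j ∈ P, (i, j) ∈ D.diagonals → IsSide P i j)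

open Classical in
/-- The finite set of the sub-polygons of the dissection. -/
def subPolygons : Finset (Finset (Fin n)) :=
  Finset.univ.filter D.IsSubPolygon

/-- The quiddity: at each vertex, the number of sub-polygons incident with it. -/
def quiddity (i : Fin n) : ℕ :=
  (D.subPolygons.filter fun P => i ∈ P).card

/-- All sub-polygons are triangles. -/
def IsTriangulation : Prop :=
  ∀ P ∈ D.subPolygons, P.card = 3

/-- The number of vertices of every sub-polygon is a multiple of `3`. -/
def Is3d : Prop :=
  ∀ P ∈ D.subPolygons, 3 ∣ P.card

end Dissection

end QContinuant

end

namespace QContinuant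

/-! Write `M(c)` for `elemMatrix c`. Everything rests on two identities: `M(1)^3 = -1` and `M(a+1)
M(1) M(b+1) = q M(a) M(b)`. Gluing a polygon with `k = 3m + 1` new vertices along a side inserts `k`
ones between two letters and raises both letters by one, so it multiplies the matrix by `(-1)^m q`
and adds one diagonal (`wordMatrix_ear`). Every dissection is built from an undissected polygon by
such gluings (`Dissection.ear_induction`): a shortest diagonal cuts off an ear. This gives the
matrix of every 3d-dissection and of every triangulation.

For the converse, `q = 1` suffices. A positive word with matrix `± Id` is either all ones, of length
divisible by 3, or contains an ear (`hasEar_or_ones`). Indeed, if no two successive letters `≥ 2`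
are separated by a run of ones of length 1 mod 3, reading the word from the right makes some vector
with entries 0 or 1 grow, so the matrix cannot be `± Id`. Cutting the ear off gives a shorter word,
to which induction applies. Ears are found inside the linear word, so no cyclic rotation is needed.
-/

theorem isSide_univ_iff {n : ℕ} {i j : Fin n} (hij : i < j) :
    IsSide Finset.univ i j ↔ (j : ℕ) = i + 1 ∨ ((i : ℕ) = 0 ∧ (j : ℕ) + 1 = n) := by
  have hj := j.isLt
  rw [Fin.lt_def] at hij
  constructor
  · rintro (h | h)
    · left
      have := h ⟨i + 1, by omega⟩ (Finset.mem_univ _)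
      simp only [Fin.lt_def] at this
      omega
    · right
      have h0 := (h ⟨0, by omega⟩ (Finset.mem_univ _)).1
      have h1 := (h ⟨n - 1, by omega⟩ (Finset.mem_univ _)).2
      simp only [Fin.le_def] at h0 h1
      omega
  · rintro (h | h)
    · left
      intro k _
      simp only [Fin.lt_def]
      omega
    · right
      intro k _
      have := k.isLt
      simp only [Fin.le_def]
      omega

theorem isSide_map_iff {n m : ℕ} (f : Fin n ↪o Fin m) (Q : Finset (Fin n)) (i j : Fin n) :
    IsSide (Q.map f.toEmbedding) (f i) (f j) ↔ IsSide Q i j := by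
  simp [IsSide]

/-! ### Sub-polygons near vertices that carry no diagonal. -/

namespace Dissection

theorem eq_of_diagonals_eq {n : ℕ} {D E : Dissection n} (h : D.diagonals = E.diagonals) :
    D = E := by
  cases D
  cases E
  cases h
  rfl

section

variable {n : ℕ} {D : Dissection n}

theorem mem_subPolygons {P : Finset (Fin n)} : P ∈ D.subPolygons ↔ D.IsSubPolygon P := by
  classical
  simp [subPolygons]

theorem IsSubPolygon.exists_third {P : Finset (Fin n)} (h : D.IsSubPolygon P) (x y : Fin n) :
    ∃ w ∈ P, w ≠ x ∧ w ≠ y := by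
  have h1 : ({x, y} : Finset (Fin n)).card < P.card :=
    lt_of_le_of_lt Finset.card_le_two h.1
  obtain ⟨w, hw, hw'⟩ := Finset.exists_mem_notMem_of_card_lt_card h1
  simp only [Finset.mem_insert, Finset.mem_singleton, not_or] at hw'
  exact ⟨w, hw, hw'.1, hw'.2⟩

/-- If two vertices of a sub-polygon have no other vertex of it between them and are not joined
by a diagonal, then they are consecutive vertices of the `n`-gon. -/
theorem IsSubPolygon.consecutive {P : Finset (Fin n)} (h : D.IsSubPolygon P) {x y : Fin n}
    (hx : x ∈ P) (hy : y ∈ P) (hxy : x < y) (hD : (x, y) ∉ D.diagonals)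
    (hgap : ∀ z ∈ P, ¬ (x < z ∧ z < y)) : (y : ℕ) = x + 1 := by
  rcases (isSide_univ_iff hxy).1
    ((h.2.1 x hx y hy hxy (Or.inl hgap)).resolve_right hD) with h1 | h1
  · exact h1
  · obtain ⟨w, hw, hwx, hwy⟩ := h.exists_third x y
    have := hgap w hw
    have := w.isLt
    simp only [Fin.lt_def, ne_eq, Fin.ext_iff] at *
    omega

/-- If the first and the last vertex of a sub-polygon are not joined by a diagonal, then they are
the first and the last vertex of the `n`-gon. -/
theorem IsSubPolygon.extremal {P : Finset (Fin n)} (h : D.IsSubPolygon P) {x y : Fin n}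
    (hx : x ∈ P) (hy : y ∈ P) (hxy : x < y) (hD : (x, y) ∉ D.diagonals)
    (hall : ∀ z ∈ P, x ≤ z ∧ z ≤ y) : (x : ℕ) = 0 ∧ (y : ℕ) + 1 = n := by
  rcases (isSide_univ_iff hxy).1
    ((h.2.1 x hx y hy hxy (Or.inr hall)).resolve_right hD) with h1 | h1
  · obtain ⟨w, hw, hwx, hwy⟩ := h.exists_third x y
    have := hall w hw
    simp only [Fin.lt_def, Fin.le_def, ne_eq, Fin.ext_iff] at *
    omega
  · exact h1

/-- With no diagonal ending at `x`, both sides of `P` at `x` are sides of the `n`-gon. If `P` has a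
later vertex, the nearest one is therefore `x + 1`; otherwise the side closing `P` forces `x` to be
the last vertex, and `y` could not exist. -/
theorem IsSubPolygon.succ_mem {P : Finset (Fin n)} (h : D.IsSubPolygon P) {x y : Fin n}
    (hx : x ∈ P) (hD : ∀ d ∈ D.diagonals, d.1 ≠ x ∧ d.2 ≠ x) (hxy : (y : ℕ) = x + 1) :
    y ∈ P := by
  by_cases hS : (P.filter fun z => x < z).Nonempty
  · have hm := Finset.min'_mem _ hS
    have hle := Finset.min'_le (P.filter fun z => x < z)
    set m := (P.filter fun z => x < z).min' hS
    rw [Finset.mem_filter] at hm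
    have := h.consecutive hx hm.1 hm.2 (fun hd => (hD _ hd).1 rfl) (fun z hz hxz =>
      absurd (hle z (Finset.mem_filter.2 ⟨hz, hxz.1⟩)) (not_le.2 hxz.2))
    rw [show y = m from Fin.ext (by omega)]
    exact hm.1
  · have hmax : ∀ z ∈ P, z ≤ x := fun z hz => by
      by_contra hc
      exact hS ⟨z, Finset.mem_filter.2 ⟨hz, not_le.1 hc⟩⟩
    have hm := Finset.min'_mem P ⟨x, hx⟩
    have hle := Finset.min'_le P
    set m := P.min' ⟨x, hx⟩
    obtain ⟨w, hw, hwx, -⟩ := h.exists_third x x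
    have hmx : m < x := lt_of_le_of_lt (hle w hw) (lt_of_le_of_ne (hmax w hw) hwx)
    have := h.extremal hm hx hmx (fun hd => (hD _ hd).2 rfl) (fun z hz => ⟨hle z hz, hmax z hz⟩)
    have := y.isLt
    omega

theorem IsSubPolygon.pred_mem {P : Finset (Fin n)} (h : D.IsSubPolygon P) {x y : Fin n}
    (hx : x ∈ P) (hD : ∀ d ∈ D.diagonals, d.1 ≠ x ∧ d.2 ≠ x) (hxy : (x : ℕ) = y + 1) :
    y ∈ P := by
  by_cases hS : (P.filter fun z => z < x).Nonempty
  · have hm := Finset.max'_mem _ hS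
    have hle := Finset.le_max' (P.filter fun z => z < x)
    set m := (P.filter fun z => z < x).max' hS
    rw [Finset.mem_filter] at hm
    have := h.consecutive hm.1 hx hm.2 (fun hd => (hD _ hd).2 rfl) (fun z hz hxz =>
      absurd (hle z (Finset.mem_filter.2 ⟨hz, hxz.2⟩)) (not_le.2 hxz.1))
    rw [show y = m from Fin.ext (by omega)]
    exact hm.1
  · have hmin : ∀ z ∈ P, x ≤ z := fun z hz => by
      by_contra hc
      exact hS ⟨z, Finset.mem_filter.2 ⟨hz, not_le.1 hc⟩⟩
    have hm := Finset.max'_mem P ⟨x, hx⟩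
    have hle := Finset.le_max' P
    set m := P.max' ⟨x, hx⟩
    obtain ⟨w, hw, hwx, -⟩ := h.exists_third x x
    have hmx : x < m := lt_of_lt_of_le (lt_of_le_of_ne (hmin w hw) (Ne.symm hwx)) (hle w hw)
    have := h.extremal hx hm hmx (fun hd => (hD _ hd).1 rfl) (fun z hz => ⟨hmin z hz, hle z hz⟩)
    omega

/-- If no diagonal ends strictly between `a` and `b`, then a sub-polygon with a vertex strictly
between them contains all vertices from `a` to `b`. -/
theorem IsSubPolygon.interval_subset {P : Finset (Fin n)} (h : D.IsSubPolygon P) {a b : ℕ}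
    (hD : ∀ d ∈ D.diagonals, ∀ x : Fin n, a < x → (x : ℕ) < b → d.1 ≠ x ∧ d.2 ≠ x)
    {x : Fin n} (hx : x ∈ P) (hax : a < x) (hxb : (x : ℕ) < b) (y : Fin n)
    (hay : a ≤ y) (hyb : (y : ℕ) ≤ b) : y ∈ P := by
  -- Each step leaves a vertex strictly between `a` and `b`, so diagonals ending at `a` or `b` do no
  -- harm.
  have up : ∀ t : ℕ, ∀ y : Fin n, (y : ℕ) = x + t → (y : ℕ) ≤ b → y ∈ P := by
    intro t
    induction t with
    | zero =>
      intro y hy _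
      rwa [show y = x from Fin.ext (by omega)]
    | succ t ih =>
      intro y hy hb
      have := y.isLt
      exact h.succ_mem (ih ⟨x + t, by omega⟩ rfl (by simp only; omega))
        (fun d hd => hD d hd _ (by simp only; omega) (by simp only; omega))
        (by simp only; omega)
  have down : ∀ t : ℕ, ∀ y : Fin n, (x : ℕ) = y + t → a ≤ (y : ℕ) → y ∈ P := by
    intro t
    induction t with
    | zero =>
      intro y hy _
      rwa [show y = x from Fin.ext (by omega)]
    | succ t ih =>
      intro y hy hb
      have := x.isLt
      exact h.pred_mem (ih ⟨y + 1, by omega⟩ (by simp only; omega) (by simp only; omega))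
        (fun d hd => hD d hd _ (by simp only; omega) (by simp only; omega)) rfl
  rcases le_total (x : ℕ) y with hxy | hxy
  · exact up (y - x) y (by omega) hyb
  · exact down (x - y) y (by omega) hay

theorem subPolygons_of_diagonals_eq_empty (hn : 3 ≤ n) (hD : D.diagonals = ∅) :
    D.subPolygons = {Finset.univ} := by
  ext P
  rw [mem_subPolygons, Finset.mem_singleton]
  constructor
  · intro h
    have hempty : ∀ d ∈ D.diagonals, ∀ x : Fin n, d.1 ≠ x ∧ d.2 ≠ x := by simp [hD]
    have hne : P.Nonempty := Finset.card_pos.1 (by have := h.1; omega)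
    obtain ⟨x, hx⟩ := hne
    obtain ⟨w, hw, -⟩ := h.exists_third x x
    ext y
    simp only [Finset.mem_univ, iff_true]
    have hsucc : ∀ z ∈ P, ∀ z' : Fin n, (z' : ℕ) = z + 1 → z' ∈ P := fun z hz z' hzz =>
      h.succ_mem hz (fun d hd => hempty d hd _) hzz
    have hpred : ∀ z ∈ P, ∀ z' : Fin n, (z : ℕ) = z' + 1 → z' ∈ P := fun z hz z' hzz =>
      h.pred_mem hz (fun d hd => hempty d hd _) hzz
    -- `interval_subset` on `[0, n - 1]` needs a starting vertex strictly inside; if `x` is an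
    -- extreme vertex, its neighbour serves.
    obtain ⟨v, hv, hv0, hvn⟩ : ∃ v ∈ P, 0 < (v : ℕ) ∧ (v : ℕ) < n - 1 := by
      by_cases h0 : (x : ℕ) = 0
      · exact ⟨⟨1, by omega⟩, hsucc x hx _ (by simp [h0]), by simp, by simp only; omega⟩
      · by_cases h1 : (x : ℕ) < n - 1
        · exact ⟨x, hx, by omega, h1⟩
        · have := x.isLt
          exact ⟨⟨n - 2, by omega⟩, hpred x hx _ (by simp only; omega), by simp only; omega,
            by simp only; omega⟩
    have := y.isLt
    exact h.interval_subset (fun d hd x _ _ => hempty d hd x) hv hv0 hvn y (by omega) (by omega)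
  · rintro rfl
    exact ⟨by simpa using hn, fun i _ j _ _ h => Or.inl h, by simp [hD]⟩

theorem quiddity_of_diagonals_eq_empty (hn : 3 ≤ n) (hD : D.diagonals = ∅) (i : Fin n) :
    D.quiddity i = 1 := by
  rw [quiddity, subPolygons_of_diagonals_eq_empty hn hD, Finset.filter_singleton]
  simp

end

/-! ### Gluing an ear to a dissection. -/

/-- The order embedding of the vertices of an `n`-gon which leaves room for `k` new vertices
after the vertex `p`. -/
def gapEmb (n p k : ℕ) : Fin n ↪o Fin (n + k) :=
  OrderEmbedding.ofStrictMono
    (fun i => if (i : ℕ) ≤ p then ⟨i, by omega⟩ else ⟨i + k, by omega⟩) (by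
      intro i j hij
      rw [Fin.lt_def] at hij
      simp only [Fin.lt_def]
      split_ifs <;> simp only <;> omega)

theorem gapEmb_val {n : ℕ} (p k : ℕ) (i : Fin n) :
    (gapEmb n p k i : ℕ) = if (i : ℕ) ≤ p then (i : ℕ) else i + k := by
  refine Eq.trans (congrArg Fin.val (congrFun (OrderEmbedding.coe_ofStrictMono _) i)) ?_
  split_ifs <;> rfl

theorem exists_gapEmb_eq {n p k : ℕ} (hp : p + 1 < n) (x : Fin (n + k))
    (hx : ¬ (p < (x : ℕ) ∧ (x : ℕ) < p + k + 1)) : ∃ i, gapEmb n p k i = x := by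
  have := x.isLt
  by_cases h : (x : ℕ) ≤ p
  · refine ⟨⟨x, by omega⟩, Fin.ext ?_⟩
    rw [gapEmb_val]
    simp [h]
  · refine ⟨⟨x - k, by omega⟩, Fin.ext ?_⟩
    rw [gapEmb_val]
    simp only
    split_ifs <;> omega

theorem gapEmb_notMem_gap {n : ℕ} (p k : ℕ) (i : Fin n) :
    ¬ (p < (gapEmb n p k i : ℕ) ∧ (gapEmb n p k i : ℕ) < p + k + 1) := by
  rw [gapEmb_val]
  split_ifs <;> omega

/-- Opening the gap destroys just one side. For `n = 2` this would fail: the same pair would survive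
as the closing side. -/
theorem isSide_univ_gapEmb_iff {n p k : ℕ} (hk : 0 < k) (hn : 3 ≤ n) (hp : p + 1 < n) {i j : Fin n}
    (hij : i < j) :
    IsSide Finset.univ (gapEmb n p k i) (gapEmb n p k j) ↔
      IsSide Finset.univ i j ∧ ¬ ((i : ℕ) = p ∧ (j : ℕ) = p + 1) := by
  rw [isSide_univ_iff hij, isSide_univ_iff ((gapEmb n p k).lt_iff_lt.2 hij), gapEmb_val, gapEmb_val]
  rw [Fin.lt_def] at hij
  have := j.isLt
  split_ifs <;> omega

variable {n : ℕ}

/-- The two ends of the side along which an ear with `k` new vertices is glued. -/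
def earDiagonal {n : ℕ} {p : ℕ} (k : ℕ) (hp : p + 1 < n) : Fin (n + k) × Fin (n + k) :=
  (gapEmb n p k ⟨p, by omega⟩, gapEmb n p k ⟨p + 1, hp⟩)

theorem earDiagonal_fst_val {p k : ℕ} (hp : p + 1 < n) : ((earDiagonal k hp).1 : ℕ) = p := by
  simp [earDiagonal, gapEmb_val]

theorem earDiagonal_snd_val {p k : ℕ} (hp : p + 1 < n) :
    ((earDiagonal k hp).2 : ℕ) = p + k + 1 := by
  simp [earDiagonal, gapEmb_val]
  omega

/-- Glue a polygon with `k + 2` vertices, `k` of which are new, to the side joining the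
vertices `p` and `p + 1` of a dissected `n`-gon. -/
def insertEar (D : Dissection n) (hn : 3 ≤ n) {p k : ℕ} (hp : p + 1 < n) (hk : 0 < k) :
    Dissection (n + k) where
  diagonals := insert (earDiagonal k hp)
    (D.diagonals.map ((gapEmb n p k).toEmbedding.prodMap (gapEmb n p k).toEmbedding))
  isDiagonal := by
    intro d hd
    rw [Finset.mem_insert, Finset.mem_map] at hd
    rcases hd with rfl | ⟨d, hd, rfl⟩
    · have h : (⟨p, by omega⟩ : Fin n) < ⟨p + 1, hp⟩ := by simp [Fin.lt_def]
      refine ⟨(gapEmb n p k).lt_iff_lt.2 h, ?_⟩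
      rw [earDiagonal, isSide_univ_gapEmb_iff hk hn hp h]
      simp
    · have h := D.isDiagonal d hd
      refine ⟨(gapEmb n p k).lt_iff_lt.2 h.1, fun hs => h.2 ?_⟩
      exact ((isSide_univ_gapEmb_iff hk hn hp h.1).1 hs).1
  nonCrossing := by
    have hgap : ∀ i : Fin n, ¬ (p < (gapEmb n p k i : ℕ) ∧ (gapEmb n p k i : ℕ) < p + k + 1) :=
      gapEmb_notMem_gap p k
    have e1 := earDiagonal_fst_val (k := k) hp
    have e2 := earDiagonal_snd_val (k := k) hp
    intro d hd e he
    rw [Finset.mem_insert, Finset.mem_map] at hd he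
    rcases hd with rfl | ⟨d, hd, rfl⟩ <;> rcases he with rfl | ⟨e, he, rfl⟩
    · simp
    · have := hgap e.1
      simp only [Function.Embedding.prodMap, Function.Embedding.coeFn_mk, Prod.map,
        RelEmbedding.coe_toEmbedding, Fin.lt_def, e1, e2]
      omega
    · have := hgap d.2
      simp only [Function.Embedding.prodMap, Function.Embedding.coeFn_mk, Prod.map,
        RelEmbedding.coe_toEmbedding, Fin.lt_def, e1, e2]
      omega
    · have := D.nonCrossing d hd e he
      simpa [Function.Embedding.prodMap] using this

section

variable (D : Dissection n) (hn : 3 ≤ n) {p k : ℕ} (hp : p + 1 < n) (hk : 0 < k)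

theorem gapEmb_mem_insertEar_iff (i j : Fin n) :
    (gapEmb n p k i, gapEmb n p k j) ∈ (D.insertEar hn hp hk).diagonals ↔
      ((i : ℕ) = p ∧ (j : ℕ) = p + 1) ∨ (i, j) ∈ D.diagonals := by
  simp only [insertEar, earDiagonal, Function.Embedding.prodMap, Finset.mem_insert,
    Finset.mem_map, Function.Embedding.coeFn_mk, Prod.exists, Prod.map,
    RelEmbedding.coe_toEmbedding, Prod.mk.injEq, EmbeddingLike.apply_eq_iff_eq]
  refine or_congr (by simp [Fin.ext_iff]) ⟨?_, fun h => ⟨i, j, h, rfl, rfl⟩⟩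
  rintro ⟨a, b, h, rfl, rfl⟩
  exact h

theorem insertEar_endpoints {d : Fin (n + k) × Fin (n + k)}
    (hd : d ∈ (D.insertEar hn hp hk).diagonals) :
    ∃ i j, d = (gapEmb n p k i, gapEmb n p k j) := by
  simp only [insertEar, Finset.mem_insert, Finset.mem_map] at hd
  rcases hd with rfl | ⟨d, hd, rfl⟩
  · exact ⟨_, _, rfl⟩
  · exact ⟨d.1, d.2, rfl⟩

theorem card_diagonals_insertEar :
    (D.insertEar hn hp hk).diagonals.card = D.diagonals.card + 1 := by
  rw [insertEar, Finset.card_insert_of_notMem, Finset.card_map]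
  rw [Finset.mem_map]
  rintro ⟨d, hd, h⟩
  simp only [earDiagonal, Function.Embedding.prodMap, Function.Embedding.coeFn_mk, Prod.map,
    RelEmbedding.coe_toEmbedding, Prod.mk.injEq, EmbeddingLike.apply_eq_iff_eq] at h
  have h' := D.isDiagonal d hd
  apply h'.2
  rw [isSide_univ_iff h'.1, h.1, h.2]
  simp

/-- The pair `p, p + 1` stops being a side but becomes a diagonal, so "side or diagonal" is
unaffected. The new diagonal cannot cut `Q`, since no old vertex lies between its ends. -/
theorem isSubPolygon_map_gapEmb_iff (Q : Finset (Fin n)) :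
    (D.insertEar hn hp hk).IsSubPolygon (Q.map (gapEmb n p k).toEmbedding) ↔
      D.IsSubPolygon Q := by
  have hlast : ∀ i j : Fin n, (i : ℕ) = p → (j : ℕ) = p + 1 → IsSide Q i j := by
    intro i j hi hj
    left
    intro z _
    simp only [Fin.lt_def]
    omega
  unfold IsSubPolygon
  rw [Finset.card_map]
  simp only [Finset.forall_mem_map, RelEmbedding.coe_toEmbedding, isSide_map_iff,
    gapEmb_mem_insertEar_iff, OrderEmbedding.lt_iff_lt]
  refine and_congr_right fun _ => and_congr ?_ ?_
  · refine forall₂_congr fun i _ => forall₂_congr fun j _ => ?_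
    refine forall_congr' fun hij => imp_congr_right fun _ => ?_
    rw [isSide_univ_gapEmb_iff hk hn hp hij]
    by_cases h : (i : ℕ) = p ∧ (j : ℕ) = p + 1
    · simp [isSide_univ_iff hij, h]
    · simp [h]
  · refine forall₂_congr fun i _ => forall₂_congr fun j _ => ?_
    constructor
    · exact fun h hd => h (Or.inr hd)
    · rintro h (h' | h')
      · exact hlast i j h'.1 h'.2
      · exact h h'

/-- The vertex set of the ear glued by `insertEar`. -/
def ear : Finset (Fin (n + k)) :=
  Finset.Icc (earDiagonal k hp).1 (earDiagonal k hp).2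

theorem mem_ear (x : Fin (n + k)) : x ∈ ear (k := k) hp ↔ p ≤ (x : ℕ) ∧ (x : ℕ) ≤ p + k + 1 := by
  rw [ear, Finset.mem_Icc, Fin.le_def, Fin.le_def, earDiagonal_fst_val, earDiagonal_snd_val]

theorem card_ear : (ear (k := k) hp).card = k + 2 := by
  rw [ear, Fin.card_Icc, earDiagonal_fst_val, earDiagonal_snd_val]
  omega

theorem isSubPolygon_ear : (D.insertEar hn hp hk).IsSubPolygon (ear hp) := by
  have e1 := earDiagonal_fst_val (k := k) hp
  have e2 := earDiagonal_snd_val (k := k) hp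
  have hear : ∀ x : Fin (n + k), x ∈ ear (k := k) hp ↔ _ := mem_ear hp
  refine ⟨by rw [card_ear]; omega, ?_, ?_⟩
  · intro i hi j hj hij hs
    rw [isSide_univ_iff hij]
    rw [hear] at hi hj
    have := i.isLt
    have := j.isLt
    rw [Fin.lt_def] at hij
    rcases hs with hs | hs
    · have := hs ⟨i + 1, by omega⟩ ((hear _).2 ⟨by simp only; omega, by simp only; omega⟩)
      simp only [Fin.lt_def] at this
      omega
    · right
      have h1 := (hs (earDiagonal k hp).1 ((hear _).2 (by omega))).1
      have h2 := (hs (earDiagonal k hp).2 ((hear _).2 (by omega))).2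
      rw [Fin.le_def] at h1 h2
      have h3 : (i, j) = earDiagonal k hp := Prod.ext (Fin.ext (by simp only; omega))
        (Fin.ext (by simp only; omega))
      rw [h3]
      exact Finset.mem_insert_self _ _
  · intro i hi j hj hd
    have hlt := ((D.insertEar hn hp hk).isDiagonal _ hd).1
    obtain ⟨a, b, hab⟩ := D.insertEar_endpoints hn hp hk hd
    rw [Prod.mk.injEq] at hab
    have ha := gapEmb_notMem_gap p k a
    have hb := gapEmb_notMem_gap p k b
    rw [← hab.1] at ha
    rw [← hab.2] at hb
    rw [hear] at hi hj
    rw [Fin.lt_def] at hlt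
    right
    intro z hz
    rw [hear] at hz
    rw [Fin.le_def, Fin.le_def]
    simp only at hlt hi hj
    omega

/-- A sub-polygon with a vertex in the gap contains the whole ear by `interval_subset`. The ear
diagonal is then one of its sides with a vertex on the gap side, so nothing lies beyond it. A
sub-polygon avoiding the gap comes from `D`. -/
theorem subPolygons_insertEar :
    (D.insertEar hn hp hk).subPolygons = insert (ear hp)
      (D.subPolygons.map (Finset.mapEmbedding (gapEmb n p k).toEmbedding).toEmbedding) := by
  ext P
  rw [mem_subPolygons, Finset.mem_insert, Finset.mem_map]
  constructor
  · intro h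
    by_cases hP : ∃ x ∈ P, p < (x : ℕ) ∧ (x : ℕ) < p + k + 1
    · left
      obtain ⟨x, hx, hpx, hxk⟩ := hP
      have hsub : ∀ y : Fin (n + k), p ≤ (y : ℕ) → (y : ℕ) ≤ p + k + 1 → y ∈ P := by
        refine h.interval_subset (fun d hd z hz hz' => ?_) hx hpx hxk
        obtain ⟨a, b, rfl⟩ := D.insertEar_endpoints hn hp hk hd
        have ha := gapEmb_notMem_gap p k a
        have hb := gapEmb_notMem_gap p k b
        constructor
        · rintro rfl
          exact ha ⟨hz, hz'⟩
        · rintro rfl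
          exact hb ⟨hz, hz'⟩
      have e1 := earDiagonal_fst_val (k := k) hp
      have e2 := earDiagonal_snd_val (k := k) hp
      rcases h.2.2 _ (hsub (earDiagonal k hp).1 (by omega) (by omega)) _
        (hsub (earDiagonal k hp).2 (by omega) (by omega)) (Finset.mem_insert_self _ _) with hs | hs
      · exact absurd (by rw [Fin.lt_def, Fin.lt_def]; omega) (hs x hx)
      · ext y
        rw [mem_ear]
        refine ⟨fun hy => ?_, fun hy => hsub y hy.1 hy.2⟩
        have := hs y hy
        rw [Fin.le_def, Fin.le_def] at this
        omega
    · right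
      push Not at hP
      obtain ⟨Q, -, rfl⟩ : ∃ Q ⊆ Finset.univ, P = Q.map (gapEmb n p k).toEmbedding := by
        rw [← Finset.subset_map_iff]
        intro x hx
        obtain ⟨i, rfl⟩ := exists_gapEmb_eq hp x (fun hc => absurd hc.2 (not_lt.2 (hP x hx hc.1)))
        exact Finset.mem_map_of_mem _ (Finset.mem_univ _)
      exact ⟨Q, mem_subPolygons.2 ((D.isSubPolygon_map_gapEmb_iff hn hp hk Q).1 h), rfl⟩
  · rintro (rfl | ⟨Q, hQ, rfl⟩)
    · exact D.isSubPolygon_ear hn hp hk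
    · exact (D.isSubPolygon_map_gapEmb_iff hn hp hk Q).2 (mem_subPolygons.1 hQ)

theorem ear_ne_map (hk : 0 < k) (Q : Finset (Fin n)) :
    ear (k := k) hp ≠ Q.map (gapEmb n p k).toEmbedding := by
  intro h
  have hx : (⟨p + 1, by omega⟩ : Fin (n + k)) ∈ ear (k := k) hp := by
    rw [mem_ear]
    simp only
    omega
  rw [h, Finset.mem_map] at hx
  obtain ⟨i, -, hi⟩ := hx
  apply gapEmb_notMem_gap p k i
  have := congrArg Fin.val hi
  simp only [RelEmbedding.coe_toEmbedding] at this
  omega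

theorem quiddity_insertEar (x : Fin (n + k)) :
    (D.insertEar hn hp hk).quiddity x =
      (D.subPolygons.filter fun Q => x ∈ Q.map (gapEmb n p k).toEmbedding).card +
        if p ≤ (x : ℕ) ∧ (x : ℕ) ≤ p + k + 1 then 1 else 0 := by
  rw [quiddity, subPolygons_insertEar, Finset.filter_insert, Finset.filter_map]
  simp only [mem_ear]
  split_ifs with h
  · rw [Finset.card_insert_of_notMem, Finset.card_map]
    · rfl
    · intro hm
      obtain ⟨Q, -, hQ⟩ := Finset.mem_map.1 hm
      exact ear_ne_map hp hk Q hQ.symm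
  · rw [Finset.card_map]
    rfl

theorem quiddity_insertEar_gapEmb (i : Fin n) :
    (D.insertEar hn hp hk).quiddity (gapEmb n p k i) =
      D.quiddity i + if (i : ℕ) = p ∨ (i : ℕ) = p + 1 then 1 else 0 := by
  rw [quiddity_insertEar, quiddity, gapEmb_val]
  congr 1
  · simp
  · congr 1
    apply propext
    split_ifs <;> omega

theorem quiddity_insertEar_gap (x : Fin (n + k)) (h1 : p < (x : ℕ)) (h2 : (x : ℕ) < p + k + 1) :
    (D.insertEar hn hp hk).quiddity x = 1 := by
  rw [quiddity_insertEar, if_pos ⟨h1.le, h2.le⟩, Finset.filter_eq_empty_iff.2]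
  · simp
  · intro Q _ hx
    obtain ⟨i, -, hi⟩ := Finset.mem_map.1 hx
    simp only [RelEmbedding.coe_toEmbedding] at hi
    apply gapEmb_notMem_gap p k i
    rw [hi]
    exact ⟨h1, h2⟩

theorem is3d_insertEar_iff : (D.insertEar hn hp hk).Is3d ↔ D.Is3d ∧ 3 ∣ k + 2 := by
  simp only [Is3d, subPolygons_insertEar, Finset.forall_mem_insert, card_ear, Finset.forall_mem_map]
  simp [and_comm]

theorem isTriangulation_insertEar_iff :
    (D.insertEar hn hp hk).IsTriangulation ↔ D.IsTriangulation ∧ k = 1 := by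
  simp only [IsTriangulation, subPolygons_insertEar, Finset.forall_mem_insert, card_ear,
    Finset.forall_mem_map]
  simp [and_comm]

/-- The quiddity after gluing an ear, as a word. -/
theorem ofFn_quiddity_insertEar {u v : List ℕ} {a b : ℕ}
    (h : List.ofFn D.quiddity = u ++ a :: b :: v) (hu : u.length = p) :
    List.ofFn (D.insertEar hn hp hk).quiddity =
      u ++ (a + 1) :: (List.replicate k 1 ++ (b + 1) :: v) := by
  have hlen : n = u.length + (v.length + 2) := by
    simpa [add_assoc] using congrArg List.length h
  have hget : ∀ i : Fin n, D.quiddity i = (u ++ a :: b :: v)[(i : ℕ)]'(by simp; omega) := by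
    intro i
    simp only [← h]
    simp
  subst hu
  apply List.ext_getElem
  · simp
    omega
  · intro m h1 h2
    rw [List.getElem_ofFn]
    rw [List.length_ofFn] at h1
    by_cases hm : u.length < m ∧ m < u.length + k + 1
    · rw [quiddity_insertEar_gap _ _ _ _ _ hm.1 hm.2,
        List.getElem_append_right (by omega)]
      obtain ⟨t, rfl⟩ : ∃ t, m = u.length + (t + 1) := ⟨m - u.length - 1, by omega⟩
      simp only [Nat.add_sub_cancel_left, List.getElem_cons_succ]
      rw [List.getElem_append_left (by simp; omega)]
      simp
    · obtain ⟨i, hi⟩ := exists_gapEmb_eq hp ⟨m, h1⟩ hm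
      rw [← hi, quiddity_insertEar_gapEmb, hget]
      have hi' := congrArg Fin.val hi
      rw [gapEmb_val] at hi'
      simp only at hi'
      have := i.isLt
      rcases lt_trichotomy (i : ℕ) u.length with hiu | hiu | hiu
      · rw [if_pos hiu.le] at hi'
        rw [if_neg (by omega), List.getElem_append_left hiu, List.getElem_append_left (by omega)]
        simp [hi']
      · rw [if_pos hiu.le] at hi'
        rw [if_pos (by omega), List.getElem_append_right (by omega),
          List.getElem_append_right (by omega)]
        simp [← hi', hiu]
      · rw [if_neg (by omega)] at hi'
        obtain ⟨t, ht⟩ : ∃ t, (i : ℕ) = u.length + (t + 1) := ⟨i - u.length - 1, by omega⟩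
        have hmt : m = u.length + ((k + t) + 1) := by omega
        subst hmt
        simp only [ht]
        rw [List.getElem_append_right (by omega), List.getElem_append_right (by omega)]
        simp only [Nat.add_sub_cancel_left, List.getElem_cons_succ]
        rw [List.getElem_append_right (by simp)]
        simp only [List.length_replicate, Nat.add_sub_cancel_left]
        -- `t = 0` is the vertex `p + 1`, whose letter `b` is raised; later vertices keep their
        -- letters.
        cases t with
        | zero => simp
        | succ t => simp

end

/-! ### Ear decomposition of dissections. -/

/-- Every dissection with a diagonal arises by gluing an ear. -/
theorem exists_eq_insertEar {N : ℕ} (E : Dissection N) (hE : E.diagonals.Nonempty) :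
    ∃ (n p k : ℕ) (hn : 3 ≤ n) (hp : p + 1 < n) (hk : 0 < k) (hN : N = n + k) (D : Dissection n),
      hN ▸ E = D.insertEar hn hp hk := by
  obtain ⟨⟨i, j⟩, hd, hmin⟩ := Finset.exists_min_image E.diagonals
    (fun d => (d.2 : ℕ) - d.1) hE
  have hdiag := E.isDiagonal _ hd
  have hij := hdiag.1
  have hs := hdiag.2
  rw [isSide_univ_iff hij] at hs
  simp only [Fin.lt_def] at hij hs hmin
  have := j.isLt
  obtain ⟨k, hk⟩ : ∃ k, (j : ℕ) = i + k + 1 := ⟨j - i - 1, by omega⟩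
  obtain ⟨n, rfl⟩ : ∃ n, N = n + k := ⟨N - k, by omega⟩
  have hk0 : 0 < k := by omega
  have hn : 3 ≤ n := by omega
  have hp : (i : ℕ) + 1 < n := by omega
  have hijE : (i, j) = earDiagonal k hp := Prod.ext
    (Fin.ext (by rw [earDiagonal_fst_val])) (Fin.ext (by rw [earDiagonal_snd_val]; exact hk))
  -- A diagonal with an end strictly between `i` and `j` cannot cross `(i, j)`, so it would span a
  -- smaller difference, against minimality.
  have hout : ∀ e ∈ E.diagonals, ¬ ((i : ℕ) < e.1 ∧ (e.1 : ℕ) < i + k + 1) ∧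
      ¬ ((i : ℕ) < e.2 ∧ (e.2 : ℕ) < i + k + 1) := by
    intro e he
    have h1 := E.nonCrossing _ hd e he
    have h2 := E.nonCrossing e he _ hd
    have h3 := hmin e he
    have h4 := (E.isDiagonal e he).1
    simp only [Fin.lt_def] at h1 h2 h4
    omega
  classical
  -- The pair `(i, i + 1)` is excluded because its image is the cut diagonal, which is only a side
  -- of the smaller polygon.
  let D : Dissection n :=
    { diagonals := Finset.univ.filter fun d =>
        (gapEmb n i k d.1, gapEmb n i k d.2) ∈ E.diagonals ∧ ¬ ((d.1 : ℕ) = i ∧ (d.2 : ℕ) = i + 1)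
      isDiagonal := by
        intro d h
        rw [Finset.mem_filter] at h
        have hE := E.isDiagonal _ h.2.1
        have hlt : d.1 < d.2 := (gapEmb n i k).lt_iff_lt.1 hE.1
        refine ⟨hlt, fun hc => hE.2 ?_⟩
        exact (isSide_univ_gapEmb_iff hk0 hn hp hlt).2 ⟨hc, h.2.2⟩
      nonCrossing := by
        intro d h e h'
        rw [Finset.mem_filter] at h h'
        simpa using E.nonCrossing _ h.2.1 _ h'.2.1 }
  refine ⟨n, i, k, hn, hp, hk0, rfl, D, eq_of_diagonals_eq ?_⟩
  ext e
  constructor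
  · intro he
    obtain ⟨a, ha⟩ := exists_gapEmb_eq hp e.1 (hout e he).1
    obtain ⟨b, hb⟩ := exists_gapEmb_eq hp e.2 (hout e he).2
    have he' : e = (gapEmb n i k a, gapEmb n i k b) := by rw [ha, hb]
    rw [he'] at he ⊢
    rw [gapEmb_mem_insertEar_iff]
    by_cases hab : (a : ℕ) = i ∧ (b : ℕ) = i + 1
    · exact Or.inl hab
    · exact Or.inr (Finset.mem_filter.2 ⟨Finset.mem_univ _, he, hab⟩)
  · intro he
    obtain ⟨a, b, rfl⟩ := D.insertEar_endpoints hn hp hk0 he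
    rw [gapEmb_mem_insertEar_iff] at he
    rcases he with hab | hab
    · have : (gapEmb n i k a, gapEmb n i k b) = (i, j) := by
        rw [hijE, earDiagonal]
        congr 2 <;> apply Fin.ext <;> simp [hab.1, hab.2]
      rw [this]
      exact hd
    · exact (Finset.mem_filter.1 hab).2.1

/-- Induction on dissections: start with the polygons without diagonals and glue ears. -/
theorem ear_induction {motive : ∀ n, Dissection n → Prop}
    (empty : ∀ n, ∀ D : Dissection n, 3 ≤ n → D.diagonals = ∅ → motive n D)
    (insertEar : ∀ (n : ℕ) (D : Dissection n) (hn : 3 ≤ n) (p k : ℕ) (hp : p + 1 < n) (hk : 0 < k),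
      motive n D → motive (n + k) (D.insertEar hn hp hk))
    (n : ℕ) (hn : 3 ≤ n) (D : Dissection n) : motive n D := by
  induction n using Nat.strong_induction_on with
  | _ N ih =>
    rcases D.diagonals.eq_empty_or_nonempty with h | h
    · exact empty N D hn h
    · obtain ⟨n, p, k, hn', hp, hk, rfl, D', hD⟩ := D.exists_eq_insertEar h
      obtain rfl : D = D'.insertEar hn' hp hk := hD
      exact insertEar n D' hn' p k hp hk (ih n (by omega) hn' D')

end Dissection

/-! ### Matrix identities over the Laurent polynomials. -/

open LaurentPolynomial (T)
open scoped Matrix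

/-- The product of the elementary matrices of the letters of a word. -/
noncomputable def wordMatrix (w : List ℕ) : Matrix (Fin 2) (Fin 2) ℤ[T;T⁻¹] :=
  (w.map elemMatrix).prod

theorem Mq_eq_wordMatrix {n : ℕ} (c : Fin n → ℕ) : Mq c = wordMatrix (List.ofFn c) := by
  rw [Mq, wordMatrix, List.map_ofFn]
  rfl

theorem wordMatrix_cons (a : ℕ) (w : List ℕ) :
    wordMatrix (a :: w) = elemMatrix a * wordMatrix w := by
  simp [wordMatrix]

theorem wordMatrix_append (u v : List ℕ) : wordMatrix (u ++ v) = wordMatrix u * wordMatrix v := by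
  simp [wordMatrix]

theorem elemMatrix_one : elemMatrix 1 = !![1, -1; 1, 0] := by
  simp [elemMatrix, qInt]

theorem elemMatrix_one_pow_three : elemMatrix 1 ^ 3 = -1 := by
  rw [elemMatrix_one]
  ext i j
  fin_cases i <;> fin_cases j <;> simp [pow_succ, Matrix.mul_apply, Fin.sum_univ_two]

theorem wordMatrix_replicate_one (m r : ℕ) :
    wordMatrix (List.replicate (3 * m + r) 1) = (-1) ^ m * elemMatrix 1 ^ r := by
  rw [wordMatrix, List.map_replicate, List.prod_replicate, pow_add, pow_mul,
    elemMatrix_one_pow_three]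

theorem qInt_succ (a : ℕ) : qInt (a + 1) = qInt a + T (a : ℤ) :=
  Finset.sum_range_succ _ _

theorem qInt_succ' (a : ℕ) : qInt (a + 1) = 1 + T 1 * qInt a := by
  rw [qInt, Finset.sum_range_succ', qInt, Finset.mul_sum, add_comm]
  congr 1
  refine Finset.sum_congr rfl fun k _ => ?_
  rw [← LaurentPolynomial.T_add]
  push_cast
  rw [add_comm]

/-- A direct computation: the left letter uses `[a+1] = [a] + q^a`, the right one `[b+1] = 1 +
q[b]`. -/
theorem elemMatrix_mul_one_mul (a b : ℕ) :
    elemMatrix (a + 1) * (elemMatrix 1 * elemMatrix (b + 1)) =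
      (T 1 : ℤ[T;T⁻¹]) • (elemMatrix a * elemMatrix b) := by
  have ha : (T (a : ℤ) : ℤ[T;T⁻¹]) = T 1 * T ((a : ℤ) - 1) := by
    rw [← LaurentPolynomial.T_add]
    congr 1
    ring
  have hb : (T (b : ℤ) : ℤ[T;T⁻¹]) = T 1 * T ((b : ℤ) - 1) := by
    rw [← LaurentPolynomial.T_add]
    congr 1
    ring
  have h1 := qInt_succ a
  have h2 := qInt_succ' b
  rw [elemMatrix_one]
  simp only [elemMatrix, Nat.cast_add, Nat.cast_one, add_sub_cancel_right, h2, ha, hb,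
    Matrix.mul_fin_two, Matrix.smul_of, Matrix.smul_cons, Matrix.smul_empty, smul_eq_mul]
  rw [ha] at h1
  ext i j : 1
  fin_cases i <;> fin_cases j <;> simp only [Fin.zero_eta, Fin.mk_one, Fin.isValue, Matrix.of_apply,
    Matrix.cons_val_zero, Matrix.cons_val_one, Matrix.cons_val_fin_one, h1] <;> ring

/-- Cutting off an ear divides the matrix of the quiddity by `q`, up to sign. -/
theorem wordMatrix_ear (u v : List ℕ) (a b m : ℕ) :
    wordMatrix (u ++ (a + 1) :: (List.replicate (3 * m + 1) 1 ++ (b + 1) :: v)) =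
      ((-1) ^ m * T 1 : ℤ[T;T⁻¹]) • wordMatrix (u ++ a :: b :: v) := by
  have hsign : ((-1) ^ m : Matrix (Fin 2) (Fin 2) ℤ[T;T⁻¹]) = ((-1) ^ m : ℤ[T;T⁻¹]) • 1 := by
    rcases neg_one_pow_eq_or ℤ[T;T⁻¹] m with h | h <;>
    rcases m.even_or_odd with h' | h' <;> simp [h'.neg_one_pow]
  have h := elemMatrix_mul_one_mul a b
  simp only [wordMatrix_append, wordMatrix_cons, wordMatrix_replicate_one, pow_one, hsign]
  calc _ = ((-1) ^ m : ℤ[T;T⁻¹]) • (wordMatrix u *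
        ((elemMatrix (a + 1) * (elemMatrix 1 * elemMatrix (b + 1))) * wordMatrix v)) := by
        simp only [Matrix.smul_mul, Matrix.mul_smul, one_mul, mul_assoc]
    _ = _ := by
        rw [h]
        simp only [Matrix.smul_mul, Matrix.mul_smul, mul_assoc, mul_smul]

/-! ### The integer matrices at `q = 1`. -/

/-- Evaluation at `q = 1`. -/
noncomputable def evalOne : ℤ[T;T⁻¹] →+* ℤ :=
  LaurentPolynomial.eval₂ (RingHom.id ℤ) 1

theorem evalOne_T (l : ℤ) : evalOne (T l) = 1 := by
  simp [evalOne, LaurentPolynomial.eval₂_T]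

/-- The matrix of a word at `q = 1`. -/
noncomputable def intMatrix (w : List ℕ) : Matrix (Fin 2) (Fin 2) ℤ :=
  evalOne.mapMatrix (wordMatrix w)

theorem intMatrix_cons (a : ℕ) (w : List ℕ) :
    intMatrix (a :: w) = !![(a : ℤ), -1; 1, 0] * intMatrix w := by
  rw [intMatrix, wordMatrix_cons, map_mul, intMatrix]
  congr 1
  ext i j
  fin_cases i <;> fin_cases j <;> simp [elemMatrix, qInt, evalOne_T]

theorem intMatrix_nil : intMatrix [] = 1 := by
  simp [intMatrix, wordMatrix]

theorem intMatrix_cons_mulVec (a : ℕ) (w : List ℕ) (f : Fin 2 → ℤ) {x y : ℤ}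
    (h : intMatrix w *ᵥ f = ![x, y]) : intMatrix (a :: w) *ᵥ f = ![a * x - y, x] := by
  rw [intMatrix_cons, ← Matrix.mulVec_mulVec, h]
  ext i
  fin_cases i <;> simp [Matrix.mulVec, dotProduct, Fin.sum_univ_two, sub_eq_add_neg]

theorem intMatrix_replicate_three_append (w : List ℕ) (s : ℕ) :
    intMatrix (List.replicate (s + 3) 1 ++ w) = -intMatrix (List.replicate s 1 ++ w) := by
  simp only [List.replicate_succ, List.cons_append, intMatrix_cons, ← mul_assoc]
  rw [← neg_one_mul (intMatrix _)]
  congr 1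
  ext i j
  fin_cases i <;> fin_cases j <;> simp

theorem intMatrix_replicate_append (w : List ℕ) (m r : ℕ) :
    ∃ ε : ℤ, (ε = 1 ∨ ε = -1) ∧
      intMatrix (List.replicate (3 * m + r) 1 ++ w) = ε • intMatrix (List.replicate r 1 ++ w) := by
  induction m with
  | zero => exact ⟨1, Or.inl rfl, by simp⟩
  | succ m ih =>
    obtain ⟨ε, hε, h⟩ := ih
    refine ⟨-ε, by omega, ?_⟩
    rw [show 3 * (m + 1) + r = 3 * m + r + 3 by ring, intMatrix_replicate_three_append, h,
      neg_smul]

/-! ### Finding an ear by a growth argument. -/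

/-- A word contains an ear if two letters `≥ 2` are separated by a run of ones whose length is
congruent to `1` modulo `3`. -/
def HasEar (w : List ℕ) : Prop :=
  ∃ (u v : List ℕ) (a b m : ℕ), 0 < a ∧ 0 < b ∧
    w = u ++ (a + 1) :: (List.replicate (3 * m + 1) 1 ++ (b + 1) :: v)

/-- A vector whose coordinates are small and which the matrix of a word with first letter `≥ 2`
makes large, up to sign. -/
def Grows (w : List ℕ) (x y : ℤ) : Prop :=
  ∃ f : Fin 2 → ℤ, (f = ![1, 0] ∨ f = ![0, 1] ∨ f = ![1, 1]) ∧
    ∃ ε : ℤ, (ε = 1 ∨ ε = -1) ∧ intMatrix w *ᵥ f = ![ε * x, ε * y]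

/-- Up to sign, `f` is the preimage of `(1, 0)` under `M(1)^s`; since `M(1)^3 = -1`, only three
vectors occur. -/
theorem exists_small_vector (s : ℕ) :
    ∃ f : Fin 2 → ℤ, (f = ![1, 0] ∨ f = ![0, 1] ∨ f = ![1, 1]) ∧
      ∃ ε : ℤ, (ε = 1 ∨ ε = -1) ∧ intMatrix (List.replicate s 1) *ᵥ f = ![ε, 0] := by
  obtain ⟨m, r, hr, rfl⟩ : ∃ m r, r < 3 ∧ s = 3 * m + r :=
    ⟨s / 3, s % 3, Nat.mod_lt _ (by norm_num), by omega⟩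
  obtain ⟨ε, hε, h⟩ := intMatrix_replicate_append [] m r
  simp only [List.append_nil] at h
  rw [h]
  interval_cases r
  · exact ⟨![1, 0], by simp, ε, hε, by simp [intMatrix_nil]⟩
  · refine ⟨![0, 1], by simp, -ε, by omega, ?_⟩
    rw [Matrix.smul_mulVec, List.replicate_one,
      intMatrix_cons_mulVec 1 [] _ (x := 0) (y := 1) (by simp [intMatrix_nil])]
    simp
  · refine ⟨![1, 1], by simp, -ε, by omega, ?_⟩
    rw [Matrix.smul_mulVec, show List.replicate 2 1 = [1, 1] from rfl,
      intMatrix_cons_mulVec 1 [1] _ (intMatrix_cons_mulVec 1 [] _ (x := 1) (y := 1)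
        (by simp [intMatrix_nil]))]
    simp

/-- Letters are added on the left. A letter `c + 1 ≥ 2` met after a run of `r` ones mod 3 sends `(x,
y)`, up to sign, to `((c+1)x - y, x)` if `r = 0` and to `(cy + x, y)` if `r = 2`; both preserve `0 ≤
y < x` and `2 ≤ x`. The case `r = 1` is an ear. -/
theorem hasEar_or_ones_or_grows (w : List ℕ) (hw : ∀ a ∈ w, 0 < a) :
    HasEar w ∨ (∃ s, w = List.replicate s 1) ∨
      ∃ (s b : ℕ) (v : List ℕ) (x y : ℤ), w = List.replicate s 1 ++ (b + 1) :: v ∧ 0 < b ∧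
        0 ≤ y ∧ y < x ∧ 2 ≤ x ∧ Grows ((b + 1) :: v) x y := by
  induction w with
  | nil => exact Or.inr (Or.inl ⟨0, rfl⟩)
  | cons c w ih =>
    have hc : 0 < c := hw c (by simp)
    obtain ⟨c, rfl⟩ : ∃ c', c = c' + 1 := ⟨c - 1, by omega⟩
    rcases ih fun a ha => hw a (List.mem_cons_of_mem _ ha) with h | h | h
    · left
      obtain ⟨u, v, a, b, m, ha, hb, rfl⟩ := h
      exact ⟨(c + 1) :: u, v, a, b, m, ha, hb, rfl⟩
    · obtain ⟨s, rfl⟩ := h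
      right
      rcases Nat.eq_zero_or_pos c with rfl | hc
      · exact Or.inl ⟨s + 1, rfl⟩
      · right
        -- The rightmost letter `≥ 2` turns `± (1, 0)` into `± (c + 1, 1)`, which starts the growth.
        obtain ⟨f, hf, ε, hε, h⟩ := exists_small_vector s
        refine ⟨0, c, _, c + 1, 1, rfl, hc, by omega, by omega, by omega, f, hf, ε, hε, ?_⟩
        rw [intMatrix_cons_mulVec _ _ _ h]
        push_cast
        congr 1
        · ring
        · simp
    · obtain ⟨s, b, v, x, y, rfl, hb, hy, hyx, hx, f, hf, ε, hε, h⟩ := h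
      rcases Nat.eq_zero_or_pos c with rfl | hc
      · exact Or.inr (Or.inr ⟨s + 1, b, v, x, y, rfl, hb, hy, hyx, hx, f, hf, ε, hε, h⟩)
      · obtain ⟨m, r, hr, rfl⟩ : ∃ m r, r < 3 ∧ s = 3 * m + r :=
          ⟨s / 3, s % 3, Nat.mod_lt _ (by norm_num), by omega⟩
        obtain ⟨δ, hδ, hM⟩ := intMatrix_replicate_append ((b + 1) :: v) m r
        have hc' : (1 : ℤ) ≤ c := by exact_mod_cast hc
        interval_cases r
        · have key : intMatrix ((c + 1) :: (List.replicate (3 * m) 1 ++ (b + 1) :: v)) *ᵥ f =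
              ![(δ * ε) * ((c + 1) * x - y), (δ * ε) * x] := by
            rw [intMatrix_cons_mulVec _ _ f (x := δ * ε * x) (y := δ * ε * y)]
            · push_cast
              congr 1
              ring
            · rw [add_zero] at hM
              rw [hM, Matrix.smul_mulVec, List.replicate_zero, List.nil_append, h]
              simp [mul_assoc]
          refine Or.inr (Or.inr ⟨0, c, _, (c + 1) * x - y, x, rfl, hc, by omega, by nlinarith,
            by nlinarith, f, hf, δ * ε, ?_, key⟩)
          rcases hδ with rfl | rfl <;> rcases hε with rfl | rfl <;> simp
        · exact Or.inl ⟨[], v, c, b, m, hc, hb, rfl⟩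
        · have key : intMatrix ((c + 1) :: (List.replicate (3 * m + 2) 1 ++ (b + 1) :: v)) *ᵥ f =
              ![-(δ * ε) * (c * y + x), -(δ * ε) * y] := by
            rw [intMatrix_cons_mulVec _ _ f (x := -(δ * ε) * y) (y := δ * ε * (x - y))]
            · push_cast
              congr 1
              ring
            · rw [hM, Matrix.smul_mulVec, show List.replicate 2 1 = [1, 1] from rfl,
                List.cons_append, List.cons_append, List.nil_append,
                intMatrix_cons_mulVec _ _ _ (intMatrix_cons_mulVec _ _ _ h)]
              ext i
              fin_cases i <;> simp <;> ring
          refine Or.inr (Or.inr ⟨0, c, _, c * y + x, y, rfl, hc, hy, by nlinarith,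
            by nlinarith, f, hf, -(δ * ε), ?_, key⟩)
          rcases hδ with rfl | rfl <;> rcases hε with rfl | rfl <;> simp

/-- `M(1)` and `M(1)^2` have lower left entry 1, hence are not scalar. -/
theorem three_dvd_of_intMatrix_replicate {s : ℕ} {δ : ℤ}
    (h : intMatrix (List.replicate s 1) = δ • 1) : 3 ∣ s := by
  obtain ⟨m, r, hr, rfl⟩ : ∃ m r, r < 3 ∧ s = 3 * m + r :=
    ⟨s / 3, s % 3, Nat.mod_lt _ (by norm_num), by omega⟩
  obtain ⟨ε, hε, hM⟩ := intMatrix_replicate_append [] m r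
  simp only [List.append_nil] at hM
  rw [hM] at h
  have h10 := congrFun (congrFun h 1) 0
  interval_cases r
  · simp
  · exfalso
    simp [List.replicate_one, intMatrix_cons, intMatrix_nil] at h10
    omega
  · exfalso
    simp [show List.replicate 2 1 = [1, 1] from rfl, intMatrix_cons, intMatrix_nil] at h10
    omega

theorem hasEar_or_ones {w : List ℕ} (hw : ∀ a ∈ w, 0 < a) {δ : ℤ} (hδ : δ = 1 ∨ δ = -1)
    (h : intMatrix w = δ • 1) : HasEar w ∨ ∃ s, 3 ∣ s ∧ w = List.replicate s 1 := by
  rcases hasEar_or_ones_or_grows w hw with h1 | ⟨s, rfl⟩ | h1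
  · exact Or.inl h1
  · exact Or.inr ⟨s, three_dvd_of_intMatrix_replicate h, rfl⟩
  · exfalso
    obtain ⟨s, b, v, x, y, rfl, hb, hy, hyx, hx, f, hf, ε, hε, hv⟩ := h1
    obtain ⟨m, r, hr, rfl⟩ : ∃ m r, r < 3 ∧ s = 3 * m + r :=
      ⟨s / 3, s % 3, Nat.mod_lt _ (by norm_num), by omega⟩
    obtain ⟨η, hη, hM⟩ := intMatrix_replicate_append ((b + 1) :: v) m r
    obtain ⟨f0, f1, rfl, hf'⟩ : ∃ f0 f1 : ℤ, f = ![f0, f1] ∧ 0 ≤ f0 ∧ f0 ≤ 1 ∧ 0 ≤ f1 ∧ f1 ≤ 1 := by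
      rcases hf with rfl | rfl | rfl
      · exact ⟨1, 0, rfl, by norm_num⟩
      · exact ⟨0, 1, rfl, by norm_num⟩
      · exact ⟨1, 1, rfl, by norm_num⟩
    have hd : (δ • (1 : Matrix (Fin 2) (Fin 2) ℤ)) *ᵥ ![f0, f1] = ![δ * f0, δ * f1] := by
      rw [Matrix.smul_mulVec, Matrix.one_mulVec]
      simp
    rw [← h, hM, Matrix.smul_mulVec] at hd
    -- Up to sign the image of `f` is `(x, y)`, `(x - y, x)` or `(-y, x - y)`. The first two have an
    -- entry `≥ 2`. The third could equal `± f`, with `f` having entries 0 or 1, only if `y = 0` and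
    -- `x = 1`.
    interval_cases r
    · rw [List.replicate_zero, List.nil_append, hv] at hd
      have h0 := congrFun hd 0
      have h1 := congrFun hd 1
      simp at h0 h1
      rcases hδ with rfl | rfl <;> rcases hε with rfl | rfl <;> rcases hη with rfl | rfl <;> omega
    · rw [List.replicate_one, List.singleton_append, intMatrix_cons_mulVec _ _ _ hv] at hd
      have h0 := congrFun hd 0
      have h1 := congrFun hd 1
      simp at h0 h1
      rcases hδ with rfl | rfl <;> rcases hε with rfl | rfl <;> rcases hη with rfl | rfl <;> omega
    · rw [show List.replicate 2 1 = [1, 1] from rfl, List.cons_append, List.cons_append,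
        List.nil_append,
        intMatrix_cons_mulVec _ _ _ (intMatrix_cons_mulVec _ _ _ hv)] at hd
      have h0 := congrFun hd 0
      have h1 := congrFun hd 1
      simp at h0 h1
      rcases hδ with rfl | rfl <;> rcases hε with rfl | rfl <;> rcases hη with rfl | rfl <;> omega

theorem intMatrix_ear (u v : List ℕ) (a b m : ℕ) :
    intMatrix (u ++ (a + 1) :: (List.replicate (3 * m + 1) 1 ++ (b + 1) :: v)) =
      (-1 : ℤ) ^ m • intMatrix (u ++ a :: b :: v) := by
  rw [intMatrix, wordMatrix_ear, intMatrix]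
  ext i j
  simp [evalOne_T]

theorem two_letters_ne_scalar {a b : ℕ} (hb : 0 < b) (δ : ℤ) : intMatrix [a, b] ≠ δ • 1 := by
  intro h
  have h10 := congrFun (congrFun h 1) 0
  simp [intMatrix_cons, intMatrix_nil] at h10
  omega

/-! ### From words to dissections and back. -/

theorem ofFn_quiddity_of_diagonals_eq_empty {n : ℕ} {D : Dissection n} (hn : 3 ≤ n)
    (hD : D.diagonals = ∅) : List.ofFn D.quiddity = List.replicate n 1 := by
  rw [← List.ofFn_const]
  congr 1
  funext i
  exact D.quiddity_of_diagonals_eq_empty hn hD i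

/-- A word of positive integers whose matrix at `q = 1` is `± Id` is the quiddity of a
3d-dissection. -/
theorem exists_dissection_of_intMatrix (w : List ℕ) (hlen : 3 ≤ w.length) (hw : ∀ a ∈ w, 0 < a)
    {δ : ℤ} (hδ : δ = 1 ∨ δ = -1) (h : intMatrix w = δ • 1) :
    ∃ (n : ℕ) (D : Dissection n), D.Is3d ∧ List.ofFn D.quiddity = w := by
  induction hl : w.length using Nat.strong_induction_on generalizing w δ with
  | _ l ih =>
    rcases hasEar_or_ones hw hδ h with h1 | h1
    · obtain ⟨u, v, a, b, m, ha, hb, rfl⟩ := h1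
      rw [intMatrix_ear] at h
      obtain ⟨η, hη, h'⟩ : ∃ η : ℤ, (η = 1 ∨ η = -1) ∧ intMatrix (u ++ a :: b :: v) = η • 1 := by
        refine ⟨(-1) ^ m * δ, ?_, ?_⟩
        · rcases neg_one_pow_eq_or ℤ m with hm | hm <;> rcases hδ with rfl | rfl <;> simp [hm]
        · rw [mul_smul, ← h, smul_smul, ← mul_pow]
          simp
      -- Cutting cannot end at two letters: the lower left entry of their matrix is `b > 0`.
      have hlen' : 3 ≤ (u ++ a :: b :: v).length := by
        by_contra hc
        have hu : u = [] := List.length_eq_zero_iff.1 (by simp at hc; omega)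
        have hv : v = [] := List.length_eq_zero_iff.1 (by simp at hc; omega)
        subst hu hv
        exact two_letters_ne_scalar hb η h'
      have hw' : ∀ c ∈ u ++ a :: b :: v, 0 < c := by
        intro c hc
        simp only [List.mem_append, List.mem_cons] at hc
        rcases hc with hc | rfl | rfl | hc
        · exact hw c (by simp [hc])
        · exact ha
        · exact hb
        · exact hw c (by simp [hc])
      obtain ⟨n, D, hD, hq⟩ := ih (u ++ a :: b :: v).length (by rw [← hl]; simp) _ hlen' hw'
        hη h' rfl
      have hn := congrArg List.length hq
      rw [List.length_ofFn] at hn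
      have hp : u.length + 1 < n := by
        rw [hn]
        simp
      refine ⟨_, D.insertEar (by omega) hp (Nat.succ_pos (3 * m)), ?_, ?_⟩
      · exact (D.is3d_insertEar_iff _ _ _).2 ⟨hD, ⟨m + 1, by omega⟩⟩
      · exact D.ofFn_quiddity_insertEar _ _ _ hq rfl
    · obtain ⟨s, hs, rfl⟩ := h1
      rw [List.length_replicate] at hlen
      let D : Dissection s := ⟨∅, by simp, by simp⟩
      refine ⟨s, D, ?_, ofFn_quiddity_of_diagonals_eq_empty hlen rfl⟩
      intro P hP
      rw [Dissection.subPolygons_of_diagonals_eq_empty hlen rfl, Finset.mem_singleton] at hP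
      simpa [hP] using hs

theorem exists_ofFn_quiddity_eq {n : ℕ} (D : Dissection n) {p : ℕ} (hp : p + 1 < n) :
    ∃ (u v : List ℕ) (a b : ℕ), List.ofFn D.quiddity = u ++ a :: b :: v ∧ u.length = p := by
  have hl : (List.ofFn D.quiddity).length = n := List.length_ofFn
  refine ⟨(List.ofFn D.quiddity).take p, (List.ofFn D.quiddity).drop (p + 2),
    (List.ofFn D.quiddity)[p], (List.ofFn D.quiddity)[p + 1], ?_, by simp; omega⟩
  · conv_lhs => rw [← List.take_append_drop p (List.ofFn D.quiddity)]
    rw [List.drop_eq_getElem_cons (by omega), List.drop_eq_getElem_cons (by omega)]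

theorem wordMatrix_quiddity_insertEar {n : ℕ} (D : Dissection n) (hn : 3 ≤ n) {p m : ℕ}
    (hp : p + 1 < n) :
    wordMatrix (List.ofFn (D.insertEar hn hp (Nat.succ_pos (3 * m))).quiddity) =
      ((-1) ^ m * T 1 : ℤ[T;T⁻¹]) • wordMatrix (List.ofFn D.quiddity) := by
  obtain ⟨u, v, a, b, h, hu⟩ := exists_ofFn_quiddity_eq D hp
  rw [D.ofFn_quiddity_insertEar hn hp _ h hu, h]
  exact wordMatrix_ear u v a b m

theorem wordMatrix_quiddity_of_is3d {n : ℕ} (hn : 3 ≤ n) (D : Dissection n) (hD : D.Is3d) :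
    ∃ ε : ℤ[T;T⁻¹], (ε = 1 ∨ ε = -1) ∧
      wordMatrix (List.ofFn D.quiddity) = (ε * T (D.diagonals.card : ℤ)) • 1 := by
  refine Dissection.ear_induction (motive := fun n D => D.Is3d → ∃ ε : ℤ[T;T⁻¹],
    (ε = 1 ∨ ε = -1) ∧ wordMatrix (List.ofFn D.quiddity) = (ε * T (D.diagonals.card : ℤ)) • 1)
    ?_ ?_ n hn D hD
  · intro n D hn hD h3
    have hdvd := h3 Finset.univ (by
      rw [Dissection.subPolygons_of_diagonals_eq_empty hn hD]
      simp)
    rw [Finset.card_univ, Fintype.card_fin] at hdvd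
    obtain ⟨m, rfl⟩ := hdvd
    rw [ofFn_quiddity_of_diagonals_eq_empty hn hD, hD]
    have := wordMatrix_replicate_one m 0
    rw [add_zero] at this
    rw [this]
    rcases m.even_or_odd with h | h
    · exact ⟨1, by simp, by simp [h.neg_one_pow]⟩
    · exact ⟨-1, by simp, by simp [h.neg_one_pow]⟩
  · intro n D hn p k hp hk ih h
    rw [Dissection.is3d_insertEar_iff] at h
    obtain ⟨ε, hε, hM⟩ := ih h.1
    -- The ear has `k + 2` vertices, a multiple of 3.
    obtain ⟨m, rfl⟩ : ∃ m, k = 3 * m + 1 := ⟨(k - 1) / 3, by omega⟩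
    refine ⟨(-1) ^ m * ε, ?_, ?_⟩
    · rcases neg_one_pow_eq_or ℤ[T;T⁻¹] m with hm | hm <;> rcases hε with rfl | rfl <;> simp [hm]
    · rw [wordMatrix_quiddity_insertEar, hM, Dissection.card_diagonals_insertEar, smul_smul]
      push_cast
      rw [LaurentPolynomial.T_add]
      congr 1
      ring

/-- Here the sign is determined: the initial triangle gives `M(1)^3 = -1`, and each triangular ear
(`m = 0`) contributes exactly `q` and one vertex. -/
theorem wordMatrix_quiddity_of_isTriangulation {n : ℕ} (hn : 3 ≤ n) (D : Dissection n)
    (hD : D.IsTriangulation) :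
    wordMatrix (List.ofFn D.quiddity) = -((T ((n : ℤ) - 3) : ℤ[T;T⁻¹]) • 1) := by
  refine Dissection.ear_induction (motive := fun n D => D.IsTriangulation →
    wordMatrix (List.ofFn D.quiddity) = -((T ((n : ℤ) - 3) : ℤ[T;T⁻¹]) • 1)) ?_ ?_ n hn D hD
  · intro n D hn hD h3
    have hcard := h3 Finset.univ (by
      rw [Dissection.subPolygons_of_diagonals_eq_empty hn hD]
      simp)
    rw [Finset.card_univ, Fintype.card_fin] at hcard
    subst hcard
    rw [ofFn_quiddity_of_diagonals_eq_empty hn hD]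
    have := wordMatrix_replicate_one 1 0
    rw [mul_one, add_zero] at this
    rw [this]
    simp
  · intro n D hn p k hp hk ih h
    rw [Dissection.isTriangulation_insertEar_iff] at h
    obtain ⟨h, rfl⟩ := h
    have := wordMatrix_quiddity_insertEar D hn (m := 0) hp
    simp only [pow_zero, one_mul] at this
    refine this.trans ?_
    rw [ih h, smul_neg, smul_smul, ← LaurentPolynomial.T_add]
    congr 3
    push_cast
    ring

/-- The exponent disappears at `q = 1`; the converse needs only this weaker information. -/
theorem intMatrix_ofFn_of_Mq {n : ℕ} {c : Fin n → ℕ} {l : ℤ}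
    (h : Mq c = (T l : ℤ[T;T⁻¹]) • 1 ∨ Mq c = -((T l : ℤ[T;T⁻¹]) • 1)) :
    ∃ δ : ℤ, (δ = 1 ∨ δ = -1) ∧ intMatrix (List.ofFn c) = δ • 1 := by
  have h1 : evalOne.mapMatrix ((T l : ℤ[T;T⁻¹]) • (1 : Matrix (Fin 2) (Fin 2) ℤ[T;T⁻¹])) = 1 := by
    ext i j
    fin_cases i <;> fin_cases j <;> simp [evalOne_T]
  rw [Mq_eq_wordMatrix] at h
  rcases h with h | h
  · exact ⟨1, Or.inl rfl, by rw [intMatrix, h, h1, one_smul]⟩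
  · exact ⟨-1, Or.inr rfl, by rw [intMatrix, h, map_neg, h1, neg_smul, one_smul]⟩

theorem Mq_of_is3d {n : ℕ} (hn : 3 ≤ n) (D : Dissection n) (hD : D.Is3d) :
    Mq D.quiddity = (T (D.diagonals.card : ℤ) : ℤ[T;T⁻¹]) • 1 ∨
      Mq D.quiddity = -((T (D.diagonals.card : ℤ) : ℤ[T;T⁻¹]) • 1) := by
  obtain ⟨ε, rfl | rfl, h⟩ := wordMatrix_quiddity_of_is3d hn D hD
  · left
    rw [Mq_eq_wordMatrix, h, one_mul]
  · right
    rw [Mq_eq_wordMatrix, h, neg_one_mul, neg_smul]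

end QContinuant

theorem mainTheorem8 (n : ℕ) (hn : 3 ≤ n) (c : Fin n → ℕ) (hc : ∀ i, 0 < c i) :
    ((∃ D : QContinuant.Dissection n, D.IsTriangulation ∧ D.quiddity = c) →
      QContinuant.Mq c =
        -((LaurentPolynomial.T ((n : ℤ) - 3) : ℤ[T;T⁻¹]) •
          (1 : Matrix (Fin 2) (Fin 2) ℤ[T;T⁻¹]))) ∧
    ((∃ l : ℤ,
        QContinuant.Mq c =
          (LaurentPolynomial.T l : ℤ[T;T⁻¹]) • (1 : Matrix (Fin 2) (Fin 2) ℤ[T;T⁻¹]) ∨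
        QContinuant.Mq c =
          -((LaurentPolynomial.T l : ℤ[T;T⁻¹]) • (1 : Matrix (Fin 2) (Fin 2) ℤ[T;T⁻¹]))) ↔
      ∃ D : QContinuant.Dissection n, D.Is3d ∧ D.quiddity = c) ∧
    (∀ D : QContinuant.Dissection n, D.Is3d → D.quiddity = c →
      QContinuant.Mq c =
          (LaurentPolynomial.T (D.diagonals.card : ℤ) : ℤ[T;T⁻¹]) •
            (1 : Matrix (Fin 2) (Fin 2) ℤ[T;T⁻¹]) ∨
      QContinuant.Mq c =
          -((LaurentPolynomial.T (D.diagonals.card : ℤ) : ℤ[T;T⁻¹]) •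
            (1 : Matrix (Fin 2) (Fin 2) ℤ[T;T⁻¹]))) := by

  refine ⟨?_, ⟨?_, ?_⟩, ?_⟩
  · rintro ⟨D, hD, rfl⟩
    rw [QContinuant.Mq_eq_wordMatrix]
    exact QContinuant.wordMatrix_quiddity_of_isTriangulation hn D hD
  · rintro ⟨l, h⟩
    obtain ⟨δ, hδ, hM⟩ := QContinuant.intMatrix_ofFn_of_Mq h
    obtain ⟨m, D, hD, hq⟩ := QContinuant.exists_dissection_of_intMatrix (List.ofFn c)
      (by simpa using hn) (by simpa [List.mem_ofFn] using hc) hδ hM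
    obtain rfl : m = n := by simpa using congrArg List.length hq
    exact ⟨D, hD, List.ofFn_injective hq⟩
  · rintro ⟨D, hD, rfl⟩
    exact ⟨_, QContinuant.Mq_of_is3d hn D hD⟩
  · rintro D hD rfl
    exact QContinuant.Mq_of_is3d hn D hD
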